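/- Let $\mathcal A=\{a,b\}$. For a finite word $w\in\mathcal A^*$ let $w^{(+)}$ be the shortest palindrome having $w$ as a prefix, and define $\psi:\mathcal A^*\to\mathcal A^*$ by $\psi(\varepsilon)=\varepsilon$ and $\psi(vx)=(\psi(v)x)^{(+)}$ for $v\in\mathcal A^*$, $x\in\mathcal A$. For an infinite word $y=y_1y_2\cdots$ let $\psi(y)=\lim_{n\to\infty}\psi(y_1\cdots y_n)$. In both cases the argument of $\psi$ is called the directive word of its value. A finite word is a central word of order $n$ if it equals $\psi(v)$ for some word $v$ of length $n$; a palindromic prefix of order $n$ of an infinite word $s$ is a palindromic prefix of $s$ which is a central word of order $n$. A characteristic Sturmian word is the cutting sequence of a semi-line $\{(r,\beta r): r>0\}$ with $\beta>0$ irrational, where a cut with a vertical line of the integer grid is coded by $a$ and a cut with a horizontal line by $b$. The Fibonacci word is $f=\psi((ab)^\omega)=abaababaabaab\cdots$. Say that $s$ has property (M) if, for every $n\ge 0$, the palindromic prefix of order $n$ of $s$ has the maximal number of occurrences of $b$ among all central words of order $n$ beginning with the letter $a$, i.e. every central word of order $n$ beginning with $a$ contains at most as many occurrences of $b$ as it does.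 Corollary 4.10. For a characteristic Sturmian word $s$, the directive word of $s$ begins with $aba$ if and only if $s$ begins with $abaa$. The Fibonacci word $f$ is the unique characteristic Sturmian word whose directive word begins with $aba$ and which has property (M); equivalently, $f$ is the unique characteristic Sturmian word beginning with $abaa$ which has property (M). -/

import Mathlib

namespace SturmianWords

/-- The binary alphabet `{a, b}`. -/
inductive Letter where
  | a
  | b
  deriving DecidableEq

/-- Infinite words over `{a, b}`; the letter with index `n` is the `(n+1)`-st letter. -/
abbrev InfWord : Type := ℕ → Letter

/-- The prefix of length `n` of an infinite word. -/
def prefixOf (x : InfWord) (n : ℕ) : List Letter := (List.range n).map x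

/-- The finite word `w` is a prefix of the infinite word `x`. -/
def IsPrefix (w : List Letter) (x : InfWord) : Prop := prefixOf x w.length = w

/-- `x` is the cutting sequence of the open semi-line `{(r, β * r) : r > 0}` starting from the
origin. The semi-line is parametrized by the abscissa; `t` lists in increasing order the abscissas
of all its cuts with the lines of the integer grid; a cut with a vertical line is coded by `a`, a
cut with a horizontal line by `b`. (For irrational `β` the open semi-line meets no corner.) -/
def IsCuttingSequence (β : ℝ) (x : InfWord) : Prop :=
  ∃ t : ℕ → ℝ, StrictMono t ∧
    Set.range t = {r : ℝ | 0 < r ∧ ((∃ i : ℤ, r = i) ∨ (∃ j : ℤ, β * r = j))} ∧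
    ∀ n, (x n = Letter.a → ∃ i : ℤ, t n = i) ∧ (x n = Letter.b → ∃ j : ℤ, β * t n = j)

/-- Characteristic Sturmian words: cutting sequences of semi-lines starting from the origin, with
positive irrational slope. -/
def IsCharacteristicSturmian (x : InfWord) : Prop :=
  ∃ β : ℝ, 0 < β ∧ Irrational β ∧ IsCuttingSequence β x

/-- The right palindromic closure of `w`: the shortest palindrome having `w` as a prefix
(see `palClosure_palindrome`, `prefix_palClosure` and `length_palClosure_le`). -/
def palClosure : List Letter → List Letter
  | [] => []
  | c :: w => if (c :: w).reverse = c :: w then c :: w else c :: (palClosure w ++ [c])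

theorem palClosure_palindrome (w : List Letter) : (palClosure w).Palindrome := by
  induction w with
  | nil => exact List.Palindrome.nil
  | cons c w ih =>
    unfold palClosure
    split_ifs with h
    · exact List.Palindrome.of_reverse_eq h
    · exact List.Palindrome.cons_concat c ih

theorem prefix_palClosure (w : List Letter) : w <+: palClosure w := by
  induction w with
  | nil => exact List.prefix_rfl
  | cons c w ih =>
    unfold palClosure
    split_ifs with h
    · exact List.prefix_rfl
    · exact (List.prefix_cons_inj c).2 (ih.trans (List.prefix_append _ _))

theorem length_palClosure_le (w p : List Letter) (hp : p.Palindrome) (hw : w <+: p) :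
    (palClosure w).length ≤ p.length := by
  induction w generalizing p with
  | nil => simp [palClosure]
  | cons c w ih =>
    unfold palClosure
    split_ifs with h
    · exact hw.length_le
    · cases hp with
      | nil => simp at hw
      | singleton d =>
        obtain ⟨u, hu⟩ := hw
        simp only [List.cons_append, List.cons.injEq, List.append_eq_nil_iff] at hu
        obtain ⟨rfl, rfl, rfl⟩ := hu
        simp at h
      | @cons_concat d q hq =>
        obtain ⟨rfl, hw'⟩ := List.cons_prefix_cons.1 hw
        rcases List.prefix_concat_iff.1 hw' with h' | h'
        · exact absurd (by rw [h']; exact (List.Palindrome.cons_concat c hq).reverse_eq) h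
        · simpa using ih q hq h'

/-- The palindromization map on finite words: `ψ(ε) = ε` and `ψ(v x) = (ψ(v) x)⁽⁺⁾`. -/
def psi (v : List Letter) : List Letter :=
  v.foldl (fun w x => palClosure (w ++ [x])) []

theorem psi_concat (v : List Letter) (x : Letter) :
    psi (v ++ [x]) = palClosure (psi v ++ [x]) := by
  simp [psi]

/-- The palindromization map on infinite words, `ψ(y) = lim ψ(y₁ ⋯ yₙ)`: its letter with index `n`
is the one of `ψ(y₁ ⋯ yₙ₊₁)`, a word of length at least `n + 1` (see `psi_isPrefix_psiInf`; the
default value of `getD` is never used). -/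
def psiInf (y : InfWord) : InfWord := fun n => (psi (prefixOf y (n + 1))).getD n Letter.a

theorem psi_prefixOf_succ (y : InfWord) (n : ℕ) :
    psi (prefixOf y n) ++ [y n] <+: psi (prefixOf y (n + 1)) := by
  have h : prefixOf y (n + 1) = prefixOf y n ++ [y n] := by simp [prefixOf, List.range_succ]
  rw [h, psi_concat]
  exact prefix_palClosure _

theorem psi_prefixOf_mono (y : InfWord) {m n : ℕ} (h : m ≤ n) :
    psi (prefixOf y m) <+: psi (prefixOf y n) := by
  induction n, h using Nat.le_induction with
  | base => exact List.prefix_rfl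
  | succ n _ ih => exact ih.trans ((List.prefix_append _ _).trans (psi_prefixOf_succ y n))

theorem le_length_psi_prefixOf (y : InfWord) (n : ℕ) : n ≤ (psi (prefixOf y n)).length := by
  induction n with
  | zero => exact Nat.zero_le _
  | succ n ih =>
    have h := (psi_prefixOf_succ y n).length_le
    simp only [List.length_append, List.length_singleton] at h
    omega

/-- Each `ψ(y₁ ⋯ yₙ)` is a prefix of `ψ(y)`. -/
theorem psi_isPrefix_psiInf (y : InfWord) (n : ℕ) :
    IsPrefix (psi (prefixOf y n)) (psiInf y) := by
  unfold IsPrefix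
  apply List.ext_getElem
  · simp [prefixOf]
  · intro i _ hi
    have hi' : i < (psi (prefixOf y (i + 1))).length := le_length_psi_prefixOf y (i + 1)
    have key : (psi (prefixOf y (i + 1)))[i] = (psi (prefixOf y n))[i] := by
      rcases le_total (i + 1) n with h | h
      · exact (psi_prefixOf_mono y h).getElem hi'
      · exact ((psi_prefixOf_mono y h).getElem hi).symm
    have h1 : (prefixOf (psiInf y) (psi (prefixOf y n)).length)[i]'(by simpa [prefixOf] using hi)
        = psiInf y i := by
      simp [prefixOf]
    rw [h1, psiInf, List.getD_eq_getElem _ _ hi', key]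

/-- `y` is a directive word of the infinite word `s`. -/
def IsDirectiveWord (y s : InfWord) : Prop := psiInf y = s

/-- `w` is a central word of order `n`, that is, it has a directive word of length `n`. -/
def IsCentralOfOrder (n : ℕ) (w : List Letter) : Prop :=
  ∃ v : List Letter, v.length = n ∧ psi v = w

/-- `p` is a palindromic prefix of order `n` of the infinite word `s`. -/
def IsPalPrefixOfOrder (n : ℕ) (p : List Letter) (s : InfWord) : Prop :=
  IsPrefix p s ∧ p.Palindrome ∧ IsCentralOfOrder n p

/-- The palindromic prefixes of `s` of every order `n` have the maximal number of occurrences of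
the letter `b` among the central words of order `n` beginning with the letter `a`. -/
def PalPrefixesHaveMaxB (s : InfWord) : Prop :=
  ∀ (n : ℕ) (p : List Letter), IsPalPrefixOfOrder n p s →
    ∀ w : List Letter, IsCentralOfOrder n w → [Letter.a] <+: w →
      w.count Letter.b ≤ p.count Letter.b

/-- A word with a directive word has a palindromic prefix of every order. -/
theorem exists_isPalPrefixOfOrder (y s : InfWord) (h : IsDirectiveWord y s) (n : ℕ) :
    IsPalPrefixOfOrder n (psi (prefixOf y n)) s := by
  subst h
  refine ⟨psi_isPrefix_psiInf y n, ?_, prefixOf y n, by simp [prefixOf], rfl⟩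
  cases n with
  | zero => exact List.Palindrome.nil
  | succ n =>
    have h : prefixOf y (n + 1) = prefixOf y n ++ [y n] := by simp [prefixOf, List.range_succ]
    rw [h, psi_concat]
    exact palClosure_palindrome _

/-- The infinite word `(ab)^ω = ababab⋯`. -/
def abPeriodic : InfWord := fun n => if Even n then Letter.a else Letter.b

/-- The Fibonacci word `f = ψ((ab)^ω) = abaababaabaab⋯`. -/
def fibonacciWord : InfWord := psiInf abPeriodic

end SturmianWords

open SturmianWords

namespace SturmianWords

/-! Everything rests on Justin's formula `psi_cons`: prepending `x` to the directive word applies `x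
↦ x`, `y ↦ xy` to the central word and appends `x`. So the count of `x` becomes one more than the
old length, and the other count is unchanged.

Hence `ψ(av)` has as many `b`s as `ψ(v)`, at most a Fibonacci number minus one (`count_psi_bounds`),
attained when `v = baba⋯`; thus `f` has (M). Conversely, `ψ(abav)` has `|ψ(av)| + 1` occurrences of
`b`, so (M) makes `|ψ(av)|` maximal, and only an alternating word reaches the maximum
(`eq_alternating_of_count_psi`). The third letter matters: by exchanging letters, `ab(ba)^ω` attains
the same counts as `(ab)^ω`.

The letter following `ψ(y₁⋯yₙ)` in `ψ(y)` is `yₙ₊₁`, and `ψ(ab) = aba`; this matches `aba` with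
`abaa`.

The link with geometry is that shearing the grid acts on cutting sequences by the same
substitutions. The additive Euclidean algorithm on the slope therefore yields a directive word
(`psiInf_slopeDirective`), and slope `φ - 1` yields `(ab)^ω`. -/

/-! ### The substitutions `x ↦ x`, `y ↦ xy` and Justin's formula -/

/-- The other letter. -/
def Letter.other : Letter → Letter
  | Letter.a => Letter.b
  | Letter.b => Letter.a

theorem Letter.eq_other_of_ne {x y : Letter} (h : y ≠ x) : y = x.other := by
  cases x <;> cases y <;> simp_all [Letter.other]

theorem Letter.other_ne (x : Letter) : x.other ≠ x := by
  cases x <;> simp [Letter.other]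

/-- The morphism fixing `x` and sending the other letter `y` to `xy`. -/
def subst (x : Letter) (w : List Letter) : List Letter :=
  w.flatMap fun c => if c = x then [x] else [x, c]

@[simp] theorem subst_nil (x : Letter) : subst x [] = [] := rfl

@[simp] theorem subst_append (x : Letter) (u w : List Letter) :
    subst x (u ++ w) = subst x u ++ subst x w := by
  simp [subst]

@[simp] theorem subst_cons_self (x : Letter) (w : List Letter) :
    subst x (x :: w) = x :: subst x w := by
  simp [subst]

@[simp] theorem subst_cons_other (x : Letter) (w : List Letter) :
    subst x (x.other :: w) = x :: x.other :: subst x w := by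
  simp [subst, x.other_ne]

/-- Reversal turns a block `xy` into `yx`, and `x(yx) = (xy)x` lets the extra `x` travel through all
the blocks. -/
theorem reverse_subst_concat (x : Letter) (w : List Letter) :
    (subst x w ++ [x]).reverse = subst x w.reverse ++ [x] := by
  induction w with
  | nil => simp
  | cons c w ih =>
    by_cases h : c = x
    · subst h
      simp only [List.reverse_append, List.reverse_cons, List.reverse_nil, List.nil_append,
        List.cons_append, subst_cons_self, subst_append, subst_nil] at ih ⊢
      rw [← List.cons_append, ih]
    · obtain rfl := Letter.eq_other_of_ne h
      simp only [List.reverse_append, List.reverse_cons, List.reverse_nil, List.nil_append,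
        List.cons_append, subst_cons_other, subst_append, subst_nil] at ih ⊢
      rw [← List.cons_append, ← List.cons_append, ih]
      simp

theorem subst_injective (x : Letter) : Function.Injective (subst x) := by
  -- The next letter of `subst x w ++ [x]` after an initial `x` decodes the first letter of `w`.
  have key : ∀ u w : List Letter, subst x u ++ [x] = subst x w ++ [x] → u = w := by
    have hx := x.other_ne
    -- Every block, and the appended `x`, starts with `x`; so `x.other` never opens a block.
    have head : ∀ (w l : List Letter), x.other :: l ≠ subst x w ++ [x] := by
      intro w l h
      cases w with
      | nil => simp [hx] at h
      | cons c w =>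
        by_cases hc : c = x
        · subst hc; simp [hx] at h
        · obtain rfl := Letter.eq_other_of_ne hc
          simp [hx] at h
    intro u
    induction u with
    | nil =>
      intro w h
      cases w with
      | nil => rfl
      | cons c w =>
        have := congrArg List.length h
        by_cases hc : c = x
        · subst hc; simp at this
        · obtain rfl := Letter.eq_other_of_ne hc
          simp at this
    | cons d u ih =>
      intro w h
      cases w with
      | nil =>
        have := congrArg List.length h
        by_cases hc : d = x
        · subst hc; simp at this
        · obtain rfl := Letter.eq_other_of_ne hc
          simp at this
      | cons c w =>
        by_cases hd : d = x <;> by_cases hc : c = x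
        · subst hd; subst hc
          simp only [subst_cons_self, List.cons_append, List.cons.injEq, true_and] at h
          rw [ih w h]
        · subst hd
          obtain rfl := Letter.eq_other_of_ne hc
          simp only [subst_cons_self, subst_cons_other, List.cons_append, List.cons.injEq,
            true_and] at h
          exact absurd h.symm (head _ _)
        · subst hc
          obtain rfl := Letter.eq_other_of_ne hd
          simp only [subst_cons_self, subst_cons_other, List.cons_append, List.cons.injEq,
            true_and] at h
          exact absurd h (head _ _)
        · obtain rfl := Letter.eq_other_of_ne hc
          obtain rfl := Letter.eq_other_of_ne hd
          simp only [subst_cons_other, List.cons_append, List.cons.injEq, true_and] at h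
          rw [ih w h]
  intro u w h
  exact key u w (by rw [h])

theorem reverse_subst_concat_eq_iff (x : Letter) (w : List Letter) :
    (subst x w ++ [x]).reverse = subst x w ++ [x] ↔ w.reverse = w := by
  rw [reverse_subst_concat, List.append_left_inj]
  exact (subst_injective x).eq_iff

theorem palClosure_cons_of_ne {c : Letter} {w : List Letter} (h : (c :: w).reverse ≠ c :: w) :
    palClosure (c :: w) = c :: (palClosure w ++ [c]) := by
  rw [palClosure, if_neg h]

theorem palClosure_of_reverse_eq {w : List Letter} (h : w.reverse = w) : palClosure w = w := by
  cases w with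
  | nil => rfl
  | cons c w => rw [palClosure, if_pos h]

theorem reverse_cons_concat_ne {c d : Letter} (h : c ≠ d) (w : List Letter) :
    (c :: (w ++ [d])).reverse ≠ c :: (w ++ [d]) := by
  simp [h.symm]

/-- `palClosure` strips first letters until a palindrome remains. Here every suffix ends in `x`, so
one that starts inside a block, with `x.other`, is no palindrome. Suffixes at block boundaries are
palindromes exactly when their preimages are. -/
theorem palClosure_subst_concat_self (x : Letter) (w : List Letter) :
    palClosure (subst x w ++ [x]) = subst x (palClosure w) ++ [x] := by
  have hx := x.other_ne
  induction w with
  | nil => simp [palClosure]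
  | cons c w ih =>
    by_cases hp : (c :: w).reverse = c :: w
    · rw [palClosure_of_reverse_eq hp,
        palClosure_of_reverse_eq ((reverse_subst_concat_eq_iff x _).2 hp)]
    · have hp' := mt (reverse_subst_concat_eq_iff x _).1 hp
      rw [palClosure_cons_of_ne hp]
      by_cases hc : c = x
      · subst hc
        simp only [subst_cons_self, List.cons_append] at hp' ⊢
        rw [palClosure_cons_of_ne hp', ih]
        simp
      · obtain rfl := Letter.eq_other_of_ne hc
        simp only [subst_cons_other, List.cons_append] at hp' ⊢
        rw [palClosure_cons_of_ne hp', palClosure_cons_of_ne (reverse_cons_concat_ne hx _), ih]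
        simp

/-- Now every suffix ends in `x.other`, so stripping can only stop inside a block. Such a suffix,
framed by `x` on both sides, is the image of a suffix of `w ++ [x.other]` followed by `x`, which
transfers the palindrome test. -/
theorem palClosure_subst_concat_other (x : Letter) (w : List Letter) :
    palClosure (subst x w ++ [x, x.other]) = subst x (palClosure (w ++ [x.other])) ++ [x] := by
  have hx := x.other_ne
  induction w with
  | nil => simp [palClosure, hx, hx.symm]
  | cons c w ih =>
    by_cases hc : c = x
    · subst hc
      have h1 : (c :: (subst c w ++ [c, c.other])).reverse ≠ c :: (subst c w ++ [c, c.other]) := by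
        simp [hx]
      rw [List.cons_append, palClosure_cons_of_ne (reverse_cons_concat_ne hx.symm _),
        subst_cons_self, List.cons_append, palClosure_cons_of_ne h1, ih]
      simp
    · obtain rfl := Letter.eq_other_of_ne hc
      have h1 : (x :: x.other :: (subst x w ++ [x, x.other])).reverse ≠
          x :: x.other :: (subst x w ++ [x, x.other]) := by
        simp [hx]
      have h2 : (x.other :: (subst x w ++ [x, x.other])).reverse =
          x.other :: (subst x w ++ [x, x.other]) ↔
          (x.other :: (w ++ [x.other])).reverse = x.other :: (w ++ [x.other]) := by
        have e : subst x (x.other :: (w ++ [x.other])) ++ [x] =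
            x :: (x.other :: (subst x w ++ [x, x.other]) ++ [x]) := by simp
        have e' : ∀ l : List Letter, (x :: (l ++ [x])).reverse = x :: (l ++ [x]) ↔
          l.reverse = l := by simp
        rw [← reverse_subst_concat_eq_iff x (x.other :: (w ++ [x.other])), e, e']
      rw [subst_cons_other, List.cons_append, List.cons_append, palClosure_cons_of_ne h1]
      rw [List.cons_append (as := w)]
      by_cases hp : (x.other :: (w ++ [x.other])).reverse = x.other :: (w ++ [x.other])
      · rw [palClosure_of_reverse_eq hp, palClosure_of_reverse_eq (h2.2 hp)]
        simp
      · rw [palClosure_cons_of_ne (mt h2.1 hp), ih, palClosure_cons_of_ne hp]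
        simp

/-- Justin's formula. -/
theorem psi_cons (x : Letter) (v : List Letter) : psi (x :: v) = subst x (psi v) ++ [x] := by
  induction v using List.reverseRecOn with
  | nil => simp [psi, palClosure]
  | append_singleton v y ih =>
    rw [← List.cons_append, psi_concat, psi_concat, ih]
    by_cases hy : y = x
    · subst hy
      rw [← palClosure_subst_concat_self]
      simp
    · obtain rfl := Letter.eq_other_of_ne hy
      rw [← palClosure_subst_concat_other]
      simp

/-! ### Counting letters in central words -/

theorem count_subst_self (x : Letter) (w : List Letter) :
    (subst x w).count x = w.count x + w.count x.other := by
  have hx := x.other_ne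
  induction w with
  | nil => simp
  | cons c w ih =>
    by_cases hc : c = x
    · subst hc; simp [ih, hx.symm]; omega
    · obtain rfl := Letter.eq_other_of_ne hc
      simp [ih, hx]; omega

theorem count_subst_other (x : Letter) (w : List Letter) :
    (subst x w).count x.other = w.count x.other := by
  have hx := x.other_ne
  induction w with
  | nil => simp
  | cons c w ih =>
    by_cases hc : c = x
    · subst hc; simp [ih, hx.symm]
    · obtain rfl := Letter.eq_other_of_ne hc
      simp [ih, hx.symm]

theorem Letter.other_other (x : Letter) : x.other.other = x := by cases x <;> rfl

theorem count_psi_cons_self (x : Letter) (v : List Letter) :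
    (psi (x :: v)).count x = (psi v).count x + (psi v).count x.other + 1 := by
  simp [psi_cons, count_subst_self]

theorem count_psi_cons_other (x : Letter) (v : List Letter) :
    (psi (x :: v)).count x.other = (psi v).count x.other := by
  simp [psi_cons, count_subst_other, x.other_ne.symm]

/-- The bounds on counts and on length feed each other: prepending `c` turns the length bound into
the bound on the count of `c`, and the new length is the old length plus one plus the old count of
`c.other`. -/
theorem count_psi_bounds (v : List Letter) : ∀ x : Letter,
    (psi v).count x + 1 ≤ Nat.fib (v.length + 2) ∧
    (psi v).count x + (psi v).count x.other + 2 ≤ Nat.fib (v.length + 3) := by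
  induction v with
  | nil => intro x; simp [psi, Nat.fib_add_two]
  | cons c v ih =>
    have h1 := ih c
    have h2 := ih c.other
    have e1 := count_psi_cons_self c v
    have e2 := count_psi_cons_other c v
    have f1 : Nat.fib (v.length + 4) = Nat.fib (v.length + 2) + Nat.fib (v.length + 3) :=
      Nat.fib_add_two
    have f2 : Nat.fib (v.length + 2) ≤ Nat.fib (v.length + 3) := Nat.fib_le_fib_succ
    intro x
    simp only [List.length_cons, Letter.other_other] at *
    rw [show v.length + 1 + 2 = v.length + 3 by ring, show v.length + 1 + 3 = v.length + 4 by ring]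
    by_cases hx : x = c
    · subst hx; omega
    · obtain rfl := Letter.eq_other_of_ne hx
      rw [Letter.other_other]; omega

/-- The alternating word of length `n` beginning with `c`. -/
def alternating : Letter → ℕ → List Letter
  | _, 0 => []
  | c, n + 1 => c :: alternating c.other n

@[simp] theorem length_alternating (c : Letter) (n : ℕ) : (alternating c n).length = n := by
  induction n generalizing c with
  | zero => rfl
  | succ n ih => simp [alternating, ih]

theorem count_psi_alternating (n : ℕ) : ∀ c : Letter,
    (psi (alternating c n)).count c + 1 = Nat.fib (n + 2) ∧
    (psi (alternating c n)).count c.other + 1 = Nat.fib (n + 1) := by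
  induction n with
  | zero => intro c; simp [psi, alternating]
  | succ n ih =>
    intro c
    have h := ih c.other
    have f : Nat.fib (n + 3) = Nat.fib (n + 1) + Nat.fib (n + 2) := Nat.fib_add_two
    rw [Letter.other_other] at h
    rw [alternating, count_psi_cons_self, count_psi_cons_other,
      show n + 1 + 2 = n + 3 by ring, show n + 1 + 1 = n + 2 by ring]
    omega

/-- The directive words of the longest central words alternate. -/
theorem eq_alternating_of_count_psi (v : List Letter) : ∀ c : Letter,
    Nat.fib (v.length + 4) ≤ (psi (c :: v)).count c + (psi (c :: v)).count c.other + 2 →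
    c :: v = alternating c (v.length + 1) := by
  induction v with
  | nil => intro c _; rfl
  | cons d v ih =>
    intro c h
    have b1 := count_psi_bounds (d :: v) c
    have b2 := count_psi_bounds (d :: v) c.other
    rw [count_psi_cons_self, count_psi_cons_other] at h
    have f : Nat.fib (v.length + 5) = Nat.fib (v.length + 3) + Nat.fib (v.length + 4) :=
      Nat.fib_add_two
    simp only [List.length_cons, Letter.other_other] at *
    rw [show v.length + 1 + 2 = v.length + 3 by ring,
      show v.length + 1 + 3 = v.length + 4 by ring] at b1 b2
    rw [show v.length + 1 + 4 = v.length + 5 by ring] at h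
    -- If `d = c`, the count of `c.other` is already that of `ψ(v)`, one order lower, and the total
    -- falls short of the required Fibonacci number.
    have hd : d = c.other := by
      by_contra hd
      have hd' := Letter.eq_other_of_ne hd
      rw [Letter.other_other] at hd'
      subst hd'
      have b3 := (count_psi_bounds v d.other).1
      rw [← count_psi_cons_other] at b3
      have : Nat.fib (v.length + 2) < Nat.fib (v.length + 3) := Nat.fib_lt_fib_succ (by omega)
      omega
    subst hd
    rw [alternating, ← ih c.other]
    rw [Letter.other_other]
    omega

/-! ### Prefixes and directive words -/

theorem prefixOf_succ (y : InfWord) (n : ℕ) : prefixOf y (n + 1) = prefixOf y n ++ [y n] := by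
  simp [prefixOf, List.range_succ]

@[simp] theorem length_prefixOf (y : InfWord) (n : ℕ) : (prefixOf y n).length = n := by
  simp [prefixOf]

theorem prefixOf_succ' (y : InfWord) (n : ℕ) :
    prefixOf y (n + 1) = y 0 :: prefixOf (fun k => y (k + 1)) n := by
  simp [prefixOf, List.range_succ_eq_map, Function.comp_def]

theorem prefixOf_abPeriodic (n : ℕ) : prefixOf abPeriodic n = alternating Letter.a n := by
  have key : ∀ n, prefixOf abPeriodic n = alternating Letter.a n ∧
      prefixOf (fun k => abPeriodic (k + 1)) n = alternating Letter.b n := by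
    intro n
    induction n with
    | zero => simp [prefixOf, alternating]
    | succ n ih =>
      have h2 : (fun k => abPeriodic (k + 1 + 1)) = abPeriodic := by
        funext k; simp [abPeriodic, Nat.even_add_one]
      refine ⟨?_, ?_⟩
      · rw [prefixOf_succ', ih.2]; simp [abPeriodic, alternating, Letter.other]
      · rw [prefixOf_succ', h2, ih.1]; simp [abPeriodic, alternating, Letter.other]
  exact (key n).1

theorem IsPrefix.of_prefix {u w : List Letter} {x : InfWord} (h : u <+: w) (hw : IsPrefix w x) :
    IsPrefix u x := by
  unfold IsPrefix at *
  apply List.ext_getElem (by simp)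
  intro i h1 h2
  rw [h.getElem h2]
  have h3 : i < w.length := h2.trans_le h.length_le
  have h4 : (prefixOf x w.length)[i]'(by simpa using h3) = w[i] := by simp only [hw]
  rw [← h4]
  simp [prefixOf]

theorem isPrefix_concat_iff {u : List Letter} {c : Letter} {x : InfWord} :
    IsPrefix (u ++ [c]) x ↔ IsPrefix u x ∧ x u.length = c := by
  unfold IsPrefix
  rw [List.length_append, List.length_singleton, prefixOf_succ]
  constructor
  · intro h
    have := List.append_inj' h rfl
    simpa using this
  · rintro ⟨h1, h2⟩
    rw [h1, h2]

theorem infWord_ext_of_prefixOf {x y : InfWord} (h : ∀ n, prefixOf x n = prefixOf y n) :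
    x = y := by
  funext n
  have := h (n + 1)
  rw [prefixOf_succ, prefixOf_succ, h n] at this
  simpa using this

theorem psiInf_eq_of_isPrefix {y s : InfWord} (h : ∀ n, IsPrefix (psi (prefixOf y n)) s) :
    psiInf y = s := by
  funext n
  have hl := le_length_psi_prefixOf y (n + 1)
  have h1 := h (n + 1)
  unfold IsPrefix at h1
  rw [psiInf, List.getD_eq_getElem _ _ hl]
  have h2 : (prefixOf s (psi (prefixOf y (n + 1))).length)[n]'(by simpa using hl) =
    (psi (prefixOf y (n + 1)))[n] := by simp only [h1]
  rw [← h2]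
  simp [prefixOf]

/-- Directive words are unique. -/
theorem eq_prefixOf_of_isPrefix_psi {y : InfWord} (v : List Letter)
    (h : IsPrefix (psi v) (psiInf y)) : v = prefixOf y v.length := by
  induction v using List.reverseRecOn with
  | nil => rfl
  | append_singleton v c ih =>
    rw [psi_concat] at h
    have h1 : IsPrefix (psi v ++ [c]) (psiInf y) := h.of_prefix (prefix_palClosure _)
    have h2 := isPrefix_concat_iff.1 h1
    have hv := ih h2.1
    -- The letter of `ψ(y)` right after `ψ(v)` is `c` by `h2` and `y v.length` by construction.
    have h3 : IsPrefix (psi (prefixOf y v.length) ++ [y v.length]) (psiInf y) :=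
      (psi_isPrefix_psiInf y (v.length + 1)).of_prefix (psi_prefixOf_succ y v.length)
    rw [← hv] at h3
    have h4 := (isPrefix_concat_iff.1 h3).2
    rw [List.length_append, List.length_singleton, prefixOf_succ, ← hv, ← h2.2, h4]

theorem isPrefix_psiInf_iff {y : InfWord} (v : List Letter) :
    IsPrefix (psi v) (psiInf y) ↔ IsPrefix v y := by
  constructor
  · exact fun h => (eq_prefixOf_of_isPrefix_psi v h).symm
  · intro h
    rw [← (show prefixOf y v.length = v from h)]
    exact psi_isPrefix_psiInf y _

theorem isPrefix_aba_iff (y : InfWord) :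
    IsPrefix [Letter.a, Letter.b, Letter.a] y ↔
      IsPrefix [Letter.a, Letter.b, Letter.a, Letter.a] (psiInf y) := by
  have e2 : psi [Letter.a, Letter.b] = [Letter.a, Letter.b, Letter.a] := by decide
  have e3 : psi [Letter.a, Letter.b, Letter.a] = [Letter.a, Letter.b, Letter.a, Letter.a] ++
    [Letter.b, Letter.a] := by decide
  constructor
  · intro h
    have h1 := (isPrefix_psiInf_iff _).2 h
    rw [e3] at h1
    exact h1.of_prefix (List.prefix_append _ _)
  · intro h
    have h1 := isPrefix_concat_iff (u := [Letter.a, Letter.b, Letter.a]).1 h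
    have h2 := eq_prefixOf_of_isPrefix_psi (y := y) [Letter.a, Letter.b] (by rw [e2]; exact h1.1)
    have h3 := (psi_isPrefix_psiInf y 3).of_prefix (psi_prefixOf_succ y 2)
    simp only [List.length_cons, List.length_nil, zero_add, Nat.reduceAdd] at h2
    rw [← h2, e2] at h3
    have h4 := (isPrefix_concat_iff.1 h3).2
    refine isPrefix_concat_iff (u := [Letter.a, Letter.b]).2 ⟨h2.symm, ?_⟩
    exact h4.symm.trans h1.2

/-! ### The extremal property -/

/-- A leading `a` in the directive word does not change the number of `b`s. Without it the
competitor is arbitrary, while the directive word of `f` becomes the alternating word starting with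
`b`, which attains the general bound. -/
theorem palPrefixesHaveMaxB_fibonacciWord : PalPrefixesHaveMaxB fibonacciWord := by
  rintro n p ⟨hp, -, u, rfl, rfl⟩ w ⟨v, hv, rfl⟩ ha
  have hu := eq_prefixOf_of_isPrefix_psi u hp
  rw [prefixOf_abPeriodic] at hu
  cases v with
  | nil => simp [psi] at ha
  | cons c v =>
    have hc : c = Letter.a := by
      rw [psi_cons] at ha
      cases h : psi v with
      | nil => simpa [h, eq_comm] using ha
      | cons d l =>
        rw [h] at ha
        by_cases hd : d = c
        · subst hd; simpa [eq_comm] using ha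
        · obtain rfl := Letter.eq_other_of_ne hd
          simpa [eq_comm] using ha
    subst hc
    rw [hu, ← hv, List.length_cons, alternating]
    have e1 := count_psi_cons_other Letter.a v
    have e2 := count_psi_cons_other Letter.a (alternating Letter.a.other v.length)
    have b1 := (count_psi_bounds v Letter.b).1
    have b2 := (count_psi_alternating v.length Letter.b).1
    simp only [Letter.other] at *
    omega

theorem eq_abPeriodic_of_maxB {y : InfWord} (hy : IsPrefix [Letter.a, Letter.b, Letter.a] y)
    (hM : PalPrefixesHaveMaxB (psiInf y)) : y = abPeriodic := by
  have h3 : y 0 = Letter.a ∧ y 1 = Letter.b ∧ y 2 = Letter.a := by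
    simpa [IsPrefix, prefixOf, List.range_succ] using hy
  obtain ⟨h0, h1, h2⟩ := h3
  have key : ∀ n, prefixOf y (n + 3) = prefixOf abPeriodic (n + 3) := by
    intro n
    have hp := hM (n + 3) _ (exists_isPalPrefixOfOrder y _ rfl (n + 3))
      (psi (alternating Letter.a (n + 3))) ⟨_, length_alternating _ _, rfl⟩
      (by
        rw [← prefixOf_abPeriodic]
        exact (psi_prefixOf_mono abPeriodic (show 1 ≤ n + 3 by omega)))
    have e : prefixOf y (n + 3) = Letter.a :: Letter.b :: Letter.a ::
        prefixOf (fun k => y (k + 3)) n := by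
      rw [prefixOf_succ', prefixOf_succ', prefixOf_succ', h0, h1, h2]
    rw [prefixOf_abPeriodic]
    rw [e] at hp ⊢
    set v := prefixOf (fun k => y (k + 3)) n with hv
    have hlen : v.length = n := by simp [hv]
    -- The number of `b`s in `ψ(abav)` is `|ψ(av)| + 1`; comparison with the alternating competitor
    -- gives `|ψ(av)| + 2 ≥ fib (n + 4)`, the extremal case.
    have e1 := count_psi_cons_other Letter.a (Letter.b :: Letter.a :: v)
    have e2 := count_psi_cons_self Letter.b (Letter.a :: v)
    have e3 := count_psi_cons_other Letter.a (alternating Letter.b (n + 2))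
    have b : _ = Nat.fib (n + 4) := (count_psi_alternating (n + 2) Letter.b).1
    have := eq_alternating_of_count_psi v Letter.a
    simp only [alternating, Letter.other] at *
    rw [hlen] at this
    rw [this (by omega)]
  apply infWord_ext_of_prefixOf
  intro n
  have h := congrArg (List.take n) (key n)
  have t : ∀ z : InfWord, (prefixOf z (n + 3)).take n = prefixOf z n := by
    intro z
    simp [prefixOf, ← List.map_take, List.take_range]
  rwa [t, t] at h

/-! ### Cutting sequences -/

/-- The word `w` codes the first cuts of the semi-line of slope `β`: after `p` vertical and `q`
horizontal cuts, the next cut is vertical if and only if `β * (p + 1) < q + 1`. -/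
inductive IsCutPrefix (β : ℝ) : List Letter → Prop
  | nil : IsCutPrefix β []
  | vertical {u : List Letter} (hu : IsCutPrefix β u)
      (h : β * (u.count Letter.a + 1) < u.count Letter.b + 1) : IsCutPrefix β (u ++ [Letter.a])
  | horizontal {u : List Letter} (hu : IsCutPrefix β u)
      (h : u.count Letter.b + 1 < β * (u.count Letter.a + 1)) : IsCutPrefix β (u ++ [Letter.b])

/-- Each line already crossed precedes the next line of the other family. This decides the cut that
opens a block in `subst_a` and `subst_b`. -/
theorem IsCutPrefix.bounds {β : ℝ} (hβ : 0 < β) {u : List Letter} (hu : IsCutPrefix β u) :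
    β * u.count Letter.a < u.count Letter.b + 1 ∧ u.count Letter.b < β * (u.count Letter.a + 1) := by
  induction hu with
  | nil => simp [hβ]
  | vertical _ h ih =>
    simp only [List.count_append, List.count_singleton]
    simp
    constructor <;> nlinarith
  | horizontal _ h ih =>
    simp only [List.count_append, List.count_singleton]
    simp
    constructor <;> nlinarith

/-- The shear `(p, q) ↦ (p + q, q)` sends slope `β / (1 - β)` to `β` and acts on letter counts as
the substitution does. The first bound for the old slope says that a vertical cut comes at each
block boundary (`step`); the condition for a horizontal cut at the old slope becomes the one for a
`b` after that `a`. -/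
theorem IsCutPrefix.subst_a {β : ℝ} (h0 : 0 < β) (h1 : β < 1) {u : List Letter}
    (hu : IsCutPrefix (β / (1 - β)) u) : IsCutPrefix β (subst Letter.a u ++ [Letter.a]) := by
  have hd : 0 < 1 - β := by linarith
  have hβ : 0 < β / (1 - β) := div_pos h0 hd
  have ca := count_subst_self Letter.a
  have cb := count_subst_other Letter.a
  have so := subst_cons_other Letter.a []
  simp only [Letter.other] at ca cb so
  have step : ∀ u, IsCutPrefix (β / (1 - β)) u → IsCutPrefix β (subst Letter.a u) →
      IsCutPrefix β (subst Letter.a u ++ [Letter.a]) := by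
    intro u hu hs
    refine hs.vertical ?_
    have b := (hu.bounds hβ).1
    rw [div_mul_eq_mul_div, div_lt_iff₀ hd] at b
    rw [ca, cb]
    push_cast
    linarith
  refine step u hu ?_
  induction hu with
  | nil => exact .nil
  | @vertical u hu h ih => simpa using step u hu ih
  | @horizontal u hu h ih =>
    have := (step u hu ih).horizontal (by
      rw [div_mul_eq_mul_div, lt_div_iff₀ hd] at h
      simp only [List.count_append, List.count_singleton, ca, cb]
      simp
      linarith)
    simpa [so] using this

/-- The same argument with the shear `(p, q) ↦ (p, p + q)`, from slope `β - 1` to `β`. -/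
theorem IsCutPrefix.subst_b {β : ℝ} (h1 : 1 < β) {u : List Letter}
    (hu : IsCutPrefix (β - 1) u) : IsCutPrefix β (subst Letter.b u ++ [Letter.b]) := by
  have hβ : 0 < β - 1 := by linarith
  have cb := count_subst_self Letter.b
  have ca := count_subst_other Letter.b
  have so := subst_cons_other Letter.b []
  simp only [Letter.other] at ca cb so
  have step : ∀ u, IsCutPrefix (β - 1) u → IsCutPrefix β (subst Letter.b u) →
      IsCutPrefix β (subst Letter.b u ++ [Letter.b]) := by
    intro u hu hs
    refine hs.horizontal ?_
    have b := (hu.bounds hβ).2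
    rw [ca, cb]
    push_cast
    linarith
  refine step u hu ?_
  induction hu with
  | nil => exact .nil
  | @horizontal u hu h ih => simpa using step u hu ih
  | @vertical u hu h ih =>
    have := (step u hu ih).vertical (by
      simp only [List.count_append, List.count_singleton, ca, cb]
      simp
      linarith)
    simpa [so] using this

theorem IsCutPrefix.dropLast_aux {β : ℝ} {w : List Letter} (hw : IsCutPrefix β w) :
    ∀ u c, w = u ++ [c] → IsCutPrefix β u ∧
      (c = Letter.a → β * (u.count Letter.a + 1) < u.count Letter.b + 1) ∧
      (c = Letter.b → u.count Letter.b + 1 < β * (u.count Letter.a + 1)) := by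
  intro u c h
  cases hw with
  | nil => simp at h
  | vertical hu h' =>
    obtain ⟨rfl, h2⟩ := List.append_inj' h rfl
    simp only [List.cons.injEq, and_true] at h2
    subst h2
    exact ⟨hu, fun _ => h', fun h => by cases h⟩
  | horizontal hu h' =>
    obtain ⟨rfl, h2⟩ := List.append_inj' h rfl
    simp only [List.cons.injEq, and_true] at h2
    subst h2
    exact ⟨hu, fun h => (by cases h), fun _ => h'⟩

/-- There is at most one word of each length coding the first cuts. -/
theorem IsCutPrefix.eq_of_length {β : ℝ} {u w : List Letter} (hu : IsCutPrefix β u)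
    (hw : IsCutPrefix β w) (h : u.length = w.length) : u = w := by
  induction hu generalizing w with
  | nil => exact (List.length_eq_zero_iff.1 h.symm).symm
  | @vertical u hu h' ih =>
    obtain ⟨w, c, rfl⟩ := List.eq_nil_or_concat' w |>.resolve_left (by rintro rfl; simp at h)
    obtain ⟨hw', -, hb⟩ := hw.dropLast_aux w c rfl
    obtain rfl := ih hw' (by simpa using h)
    cases c with
    | a => rfl
    | b => exact absurd (hb rfl) (not_lt.2 h'.le)
  | @horizontal u hu h' ih =>
    obtain ⟨w, c, rfl⟩ := List.eq_nil_or_concat' w |>.resolve_left (by rintro rfl; simp at h)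
    obtain ⟨hw', ha, -⟩ := hw.dropLast_aux w c rfl
    obtain rfl := ih hw' (by simpa using h)
    cases c with
    | b => rfl
    | a => exact absurd (ha rfl) (not_lt.2 h'.le)

open Classical in
/-- The next cut after the cuts coded by `u`. -/
noncomputable def nextCut (β : ℝ) (u : List Letter) : Letter :=
  if β * (u.count Letter.a + 1) < u.count Letter.b + 1 then Letter.a else Letter.b

/-- The coding of the first `n` cuts. -/
noncomputable def cutList (β : ℝ) : ℕ → List Letter
  | 0 => []
  | n + 1 => cutList β n ++ [nextCut β (cutList β n)]

/-- The coding of all cuts of the semi-line of slope `β`. -/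
noncomputable def cutWord (β : ℝ) : InfWord := fun n => nextCut β (cutList β n)

theorem prefixOf_cutWord (β : ℝ) (n : ℕ) : prefixOf (cutWord β) n = cutList β n := by
  induction n with
  | zero => rfl
  | succ n ih => rw [prefixOf_succ, ih, cutList, cutWord]

theorem natCast_ne_irrational_mul {β : ℝ} (hβ : Irrational β) (p q : ℕ) :
    β * (p + 1) ≠ q + 1 := by
  have h := hβ.mul_natCast (Nat.succ_ne_zero p)
  have := h.ne_nat (q + 1)
  push_cast at this
  exact this

theorem isCutPrefix_cutList {β : ℝ} (hβ : Irrational β) (n : ℕ) : IsCutPrefix β (cutList β n) := by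
  induction n with
  | zero => exact .nil
  | succ n ih =>
    rw [cutList, nextCut]
    split_ifs with h
    · exact ih.vertical h
    -- Equality would mean a corner of the grid, excluded by irrationality.
    · exact ih.horizontal (lt_of_le_of_ne (not_lt.1 h) (natCast_ne_irrational_mul hβ _ _).symm)

theorem IsCutPrefix.isPrefix_cutWord {β : ℝ} (hβ : Irrational β) {u : List Letter}
    (hu : IsCutPrefix β u) : IsPrefix u (cutWord β) := by
  rw [IsPrefix, prefixOf_cutWord]
  apply (isCutPrefix_cutList hβ _).eq_of_length hu
  rw [← prefixOf_cutWord, length_prefixOf]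

/-! ### Cutting sequences are the greedy words -/

/-- The abscissa of the cut following those coded by `u`. -/
noncomputable def nextAbscissa (β : ℝ) (u : List Letter) : ℝ :=
  min (u.count Letter.a + 1) ((u.count Letter.b + 1) / β)

theorem nextAbscissa_of_nextCut_a {β : ℝ} (h0 : 0 < β) {u : List Letter}
    (h : nextCut β u = Letter.a) : nextAbscissa β u = u.count Letter.a + 1 := by
  have h' : β * (u.count Letter.a + 1) < u.count Letter.b + 1 := by
    by_contra hc
    simp [nextCut, hc] at h
  rw [nextAbscissa, min_eq_left]
  rw [le_div_iff₀ h0]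
  linarith

theorem nextAbscissa_of_nextCut_b {β : ℝ} (h0 : 0 < β) {u : List Letter}
    (h : nextCut β u = Letter.b) : nextAbscissa β u = (u.count Letter.b + 1) / β := by
  have h' : ¬ β * (u.count Letter.a + 1) < u.count Letter.b + 1 := by
    intro hc
    simp [nextCut, hc] at h
  rw [nextAbscissa, min_eq_right]
  rw [div_le_iff₀ h0]
  linarith

theorem strictMono_nextAbscissa {β : ℝ} (h0 : 0 < β) (hβ : Irrational β) :
    StrictMono fun n => nextAbscissa β (cutList β n) := by
  apply strictMono_nat_of_lt_succ
  intro n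
  have hc := isCutPrefix_cutList hβ (n + 1)
  obtain ⟨-, ha, hb⟩ := hc.dropLast_aux _ _ rfl
  cases h : nextCut β (cutList β n) with
  | a =>
    have := ha h
    rw [nextAbscissa_of_nextCut_a h0 h, nextAbscissa, lt_min_iff, cutList, h, lt_div_iff₀ h0]
    simp only [List.count_append, List.count_singleton]
    simp
    linarith
  | b =>
    have := hb h
    rw [nextAbscissa_of_nextCut_b h0 h, nextAbscissa, lt_min_iff, cutList, h, div_lt_iff₀ h0,
      div_lt_div_iff_of_pos_right h0]
    simp only [List.count_append, List.count_singleton]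
    simp
    linarith

theorem length_eq_count_add_count (u : List Letter) :
    u.length = u.count Letter.a + u.count Letter.b := by
  induction u with
  | nil => rfl
  | cons c u ih => cases c <;> simp [ih] <;> omega

theorem length_cutList (β : ℝ) (n : ℕ) : (cutList β n).length = n := by
  rw [← prefixOf_cutWord, length_prefixOf]

/-- If the letter `c` occurs infinitely often, its `(k + 1)`-st occurrence exists. -/
theorem exists_nextCut_eq_and_count_eq {β : ℝ} {c : Letter}
    (h : ∀ k, ∃ n, k < (cutList β n).count c) (k : ℕ) :
    ∃ n, nextCut β (cutList β n) = c ∧ (cutList β n).count c = k := by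
  classical
  -- At the least length where the count exceeds `k`, the last letter added must be `c`.
  obtain ⟨m, hm⟩ : ∃ m, Nat.find (h k) = m + 1 := by
    apply Nat.exists_eq_succ_of_ne_zero
    intro h0
    have := Nat.find_spec (h k)
    rw [h0] at this
    simp [cutList] at this
  have h1 := Nat.find_spec (h k)
  have h2 := Nat.find_min (h k) (show m < Nat.find (h k) by omega)
  rw [hm, cutList, List.count_append, List.count_singleton] at h1
  refine ⟨m, ?_, ?_⟩ <;> by_cases hc : nextCut β (cutList β m) = c <;> simp [hc] at h1 <;>
    first | exact hc | omega

theorem exists_lt_count_cutList {β : ℝ} (h0 : 0 < β) (hβ : Irrational β) (c : Letter) (k : ℕ) :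
    ∃ n, k < (cutList β n).count c := by
  -- By `bounds`, at most `k` letters `a` leave fewer than `β(k + 1) + 1` letters `b`, and at most
  -- `k` letters `b` leave fewer than `(k + 1)/β` letters `a`; the argument for `a` uses the sharper
  -- bound `β(k + 1)`. Either way `n` is too large.
  obtain ⟨n, hn⟩ := exists_nat_gt ((k : ℝ) + β * (k + 1) + (k + 1) / β)
  refine ⟨n, ?_⟩
  have hb := (isCutPrefix_cutList hβ n).bounds h0
  have hl := length_eq_count_add_count (cutList β n)
  rw [length_cutList] at hl
  have hl' : (n : ℝ) = (cutList β n).count Letter.a + (cutList β n).count Letter.b := by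
    exact_mod_cast hl
  by_contra hk
  rw [not_lt] at hk
  have hk' : ((cutList β n).count c : ℝ) ≤ k := by exact_mod_cast hk
  have p1 : 0 < ((k : ℝ) + 1) / β := by positivity
  have p2 : 0 < β * ((k : ℝ) + 1) := by positivity
  cases c with
  | a => nlinarith [mul_le_mul_of_nonneg_left hk' h0.le]
  | b =>
    have : ((cutList β n).count Letter.a : ℝ) < (k + 1) / β := by
      rw [lt_div_iff₀ h0]; linarith
    linarith

theorem range_nextAbscissa {β : ℝ} (h0 : 0 < β) (hβ : Irrational β) :
    Set.range (fun n => nextAbscissa β (cutList β n)) =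
      {r : ℝ | 0 < r ∧ ((∃ i : ℤ, r = i) ∨ (∃ j : ℤ, β * r = j))} := by
  ext r
  constructor
  · rintro ⟨n, rfl⟩
    dsimp only
    refine ⟨?_, ?_⟩
    · rw [nextAbscissa]; positivity
    · cases h : nextCut β (cutList β n) with
      | a =>
        left
        refine ⟨(cutList β n).count Letter.a + 1, ?_⟩
        rw [nextAbscissa_of_nextCut_a h0 h]
        push_cast
        rfl
      | b =>
        right
        refine ⟨(cutList β n).count Letter.b + 1, ?_⟩
        rw [nextAbscissa_of_nextCut_b h0 h]
        push_cast
        field_simp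
  · rintro ⟨hr, ⟨i, hi⟩ | ⟨j, hj⟩⟩
    · have hi0 : 0 < i := by rw [hi] at hr; exact_mod_cast hr
      -- The `i`-th vertical line is met at the `a` preceded by `i - 1` others.
      obtain ⟨n, h1, h2⟩ := exists_nextCut_eq_and_count_eq
        (exists_lt_count_cutList h0 hβ Letter.a) (i - 1).toNat
      refine ⟨n, ?_⟩
      have h3 : ((cutList β n).count Letter.a : ℤ) = i - 1 := by rw [h2]; omega
      have h4 : ((cutList β n).count Letter.a : ℝ) = i - 1 := by exact_mod_cast h3
      dsimp only
      rw [nextAbscissa_of_nextCut_a h0 h1, h4, hi]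
      ring
    · have hj0 : 0 < j := by
        have : 0 < β * r := by positivity
        rw [hj] at this
        exact_mod_cast this
      obtain ⟨n, h1, h2⟩ := exists_nextCut_eq_and_count_eq
        (exists_lt_count_cutList h0 hβ Letter.b) (j - 1).toNat
      refine ⟨n, ?_⟩
      have h3 : ((cutList β n).count Letter.b : ℤ) = j - 1 := by rw [h2]; omega
      have h4 : ((cutList β n).count Letter.b : ℝ) = j - 1 := by exact_mod_cast h3
      dsimp only
      rw [nextAbscissa_of_nextCut_b h0 h1, h4, sub_add_cancel, ← hj]
      field_simp

/-- A strictly increasing enumeration is determined by its range, so `t` must list the greedy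
abscissas. The coding is then forced, since no cut lies on lines of both families (`hne`). -/
theorem isCuttingSequence_iff {β : ℝ} (h0 : 0 < β) (hβ : Irrational β) (x : InfWord) :
    IsCuttingSequence β x ↔ x = cutWord β := by
  have hv : ∀ n, cutWord β n = Letter.a →
      nextAbscissa β (cutList β n) = (((cutList β n).count Letter.a + 1 : ℤ) : ℝ) := by
    intro n h
    rw [nextAbscissa_of_nextCut_a h0 h]
    push_cast
    rfl
  have hh : ∀ n, cutWord β n = Letter.b →
      β * nextAbscissa β (cutList β n) = (((cutList β n).count Letter.b + 1 : ℤ) : ℝ) := by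
    intro n h
    rw [nextAbscissa_of_nextCut_b h0 h]
    push_cast
    field_simp
  constructor
  · rintro ⟨t, ht, hr, hx⟩
    rw [← range_nextAbscissa h0 hβ] at hr
    obtain rfl := (StrictMono.range_inj ht (strictMono_nextAbscissa h0 hβ)).1 hr
    have hne : ∀ (r : ℝ) (i j : ℤ), 0 < r → r = i → β * r ≠ j := by
      rintro r i j hr rfl h
      have hi : i ≠ 0 := by rintro rfl; simp at hr
      exact (hβ.mul_intCast hi).ne_int j h
    have hpos : ∀ n, 0 < nextAbscissa β (cutList β n) := by
      intro n; rw [nextAbscissa]; positivity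
    funext n
    cases h : x n <;> cases h' : cutWord β n
    · rfl
    · obtain ⟨i, hi⟩ := (hx n).1 h
      exact absurd (hh n h') (hne _ i _ (hpos n) hi)
    · obtain ⟨j, hj⟩ := (hx n).2 h
      exact absurd hj (hne _ _ j (hpos n) (hv n h'))
    · rfl
  · rintro rfl
    exact ⟨_, strictMono_nextAbscissa h0 hβ, range_nextAbscissa h0 hβ,
      fun n => ⟨fun h => ⟨_, hv n h⟩, fun h => ⟨_, hh n h⟩⟩⟩

/-! ### Directive words of characteristic Sturmian words -/

open Classical in
/-- One step of the additive Euclidean algorithm on slopes. -/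
noncomputable def slopeStep (β : ℝ) : ℝ := if β < 1 then β / (1 - β) else β - 1

open Classical in
/-- The directive word of the cutting sequence of slope `β`. -/
noncomputable def slopeDirective (β : ℝ) : InfWord := fun n =>
  if slopeStep^[n] β < 1 then Letter.a else Letter.b

theorem slopeStep_pos {β : ℝ} (h0 : 0 < β) (hβ : Irrational β) : 0 < slopeStep β := by
  rw [slopeStep]
  split_ifs with h
  · exact div_pos h0 (by linarith)
  · have := lt_of_le_of_ne (not_lt.1 h) (Ne.symm hβ.ne_one)
    linarith

theorem irrational_slopeStep {β : ℝ} (hβ : Irrational β) : Irrational (slopeStep β) := by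
  rw [slopeStep]
  split_ifs with h
  · have h1 : (1 - β) ≠ 0 := by linarith
    have e : β / (1 - β) = (1 - β)⁻¹ - ((1 : ℤ) : ℝ) := by
      push_cast; field_simp; ring
    rw [e]
    apply Irrational.sub_intCast
    apply Irrational.inv
    have := hβ.intCast_sub 1
    simpa using this
  · simpa using hβ.sub_intCast 1

/-- Justin's formula peels off the first directive letter just as `subst_a` and `subst_b` undo one
Euclidean step; the slope varies in the induction. -/
theorem isCutPrefix_psi_slopeDirective (n : ℕ) : ∀ {β : ℝ}, 0 < β → Irrational β →
    IsCutPrefix β (psi (prefixOf (slopeDirective β) n)) := by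
  induction n with
  | zero => intro β _ _; exact .nil
  | succ n ih =>
    intro β h0 hβ
    have e : (fun k => slopeDirective β (k + 1)) = slopeDirective (slopeStep β) := by
      rfl
    have h := ih (slopeStep_pos h0 hβ) (irrational_slopeStep hβ)
    rw [prefixOf_succ', e, psi_cons]
    by_cases h1 : β < 1
    · have e0 : slopeDirective β 0 = Letter.a := by simp [slopeDirective, h1]
      rw [e0]
      refine IsCutPrefix.subst_a h0 h1 ?_
      rwa [show β / (1 - β) = slopeStep β by simp [slopeStep, h1]]
    · have e0 : slopeDirective β 0 = Letter.b := by simp [slopeDirective, h1]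
      have h1' := lt_of_le_of_ne (not_lt.1 h1) (Ne.symm hβ.ne_one)
      rw [e0]
      refine IsCutPrefix.subst_b h1' ?_
      rwa [show β - 1 = slopeStep β by simp [slopeStep, h1]]

theorem psiInf_slopeDirective {β : ℝ} (h0 : 0 < β) (hβ : Irrational β) :
    psiInf (slopeDirective β) = cutWord β :=
  psiInf_eq_of_isPrefix fun n =>
    (isCutPrefix_psi_slopeDirective n h0 hβ).isPrefix_cutWord hβ

theorem IsCharacteristicSturmian.exists_isDirectiveWord {s : InfWord}
    (hs : IsCharacteristicSturmian s) : ∃ y, IsDirectiveWord y s := by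
  obtain ⟨β, h0, hβ, h⟩ := hs
  obtain rfl := (isCuttingSequence_iff h0 hβ s).1 h
  exact ⟨_, psiInf_slopeDirective h0 hβ⟩

/-- Since `φ² = φ + 1`, the Euclidean step exchanges `φ - 1 < 1` and `φ > 1`. -/
theorem slopeDirective_goldenRatio :
    slopeDirective (Real.goldenRatio - 1) = abPeriodic := by
  have g0 := Real.one_lt_goldenRatio
  have g2 := Real.goldenRatio_lt_two
  have s1 : slopeStep (Real.goldenRatio - 1) = Real.goldenRatio := by
    have : (2 : ℝ) - Real.goldenRatio ≠ 0 := by linarith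
    rw [slopeStep, if_pos (by linarith), show 1 - (Real.goldenRatio - 1) = 2 - Real.goldenRatio by
      ring, div_eq_iff this]
    linarith [Real.goldenRatio_sq]
  have s2 : slopeStep Real.goldenRatio = Real.goldenRatio - 1 := by
    rw [slopeStep, if_neg (by linarith)]
  have it : ∀ k, slopeStep^[2 * k] (Real.goldenRatio - 1) = Real.goldenRatio - 1 := by
    intro k
    rw [Function.iterate_mul]
    apply Function.iterate_fixed
    simp [s1, s2]
  funext n
  rcases Nat.even_or_odd' n with ⟨k, rfl | rfl⟩
  · rw [slopeDirective, it, if_pos (by linarith)]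
    simp [abPeriodic]
  · rw [slopeDirective, Function.iterate_succ_apply', it, s1, if_neg (by linarith)]
    simp [abPeriodic]

theorem isCharacteristicSturmian_fibonacciWord : IsCharacteristicSturmian fibonacciWord := by
  have h0 : 0 < Real.goldenRatio - 1 := by linarith [Real.one_lt_goldenRatio]
  have hβ : Irrational (Real.goldenRatio - 1) := by
    simpa using Real.goldenRatio_irrational.sub_intCast 1
  refine ⟨_, h0, hβ, (isCuttingSequence_iff h0 hβ _).2 ?_⟩
  rw [← psiInf_slopeDirective h0 hβ, slopeDirective_goldenRatio, fibonacciWord]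

theorem isDirectiveWord_aba_iff {s : InfWord} (hs : IsCharacteristicSturmian s) :
    (∃ y : InfWord, IsDirectiveWord y s ∧ IsPrefix [Letter.a, Letter.b, Letter.a] y) ↔
      IsPrefix [Letter.a, Letter.b, Letter.a, Letter.a] s := by
  constructor
  · rintro ⟨y, rfl, hy⟩
    exact (isPrefix_aba_iff y).1 hy
  · intro h
    obtain ⟨y, rfl⟩ := hs.exists_isDirectiveWord
    exact ⟨y, rfl, (isPrefix_aba_iff y).2 h⟩

theorem eq_fibonacciWord_iff (s : InfWord) :
    (IsCharacteristicSturmian s ∧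
      (∃ y : InfWord, IsDirectiveWord y s ∧ IsPrefix [Letter.a, Letter.b, Letter.a] y) ∧
      PalPrefixesHaveMaxB s) ↔ s = fibonacciWord := by
  constructor
  · rintro ⟨-, ⟨y, rfl, hy⟩, hM⟩
    rw [eq_abPeriodic_of_maxB hy hM, fibonacciWord]
  · rintro rfl
    refine ⟨isCharacteristicSturmian_fibonacciWord, ⟨abPeriodic, rfl, ?_⟩,
      palPrefixesHaveMaxB_fibonacciWord⟩
    simp [IsPrefix, prefixOf, List.range_succ, abPeriodic]

end SturmianWords

theorem corollary4p10 :
    (∀ s : InfWord, IsCharacteristicSturmian s →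
      ((∃ y : InfWord, IsDirectiveWord y s ∧ IsPrefix [Letter.a, Letter.b, Letter.a] y) ↔
        IsPrefix [Letter.a, Letter.b, Letter.a, Letter.a] s)) ∧
    (∀ s : InfWord,
      (IsCharacteristicSturmian s ∧
        (∃ y : InfWord, IsDirectiveWord y s ∧ IsPrefix [Letter.a, Letter.b, Letter.a] y) ∧
        PalPrefixesHaveMaxB s) ↔ s = fibonacciWord) ∧
    (∀ s : InfWord,
      (IsCharacteristicSturmian s ∧
        IsPrefix [Letter.a, Letter.b, Letter.a, Letter.a] s ∧
        PalPrefixesHaveMaxB s) ↔ s = fibonacciWord) := by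
  refine ⟨fun s hs => isDirectiveWord_aba_iff hs, eq_fibonacciWord_iff, fun s => ?_⟩
  rw [← eq_fibonacciWord_iff s]
  constructor
  · rintro ⟨hs, h, hM⟩
    exact ⟨hs, (isDirectiveWord_aba_iff hs).2 h, hM⟩
  · rintro ⟨hs, h, hM⟩
    exact ⟨hs, (isDirectiveWord_aba_iff hs).1 h, hM⟩
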